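/- A compact ordered space is a compact topological space $X$ with a partial order that is a closed subset of $X\times X$. Let $\mathsf{CompOrd}$ be the category of compact ordered spaces and order-preserving continuous maps. An internal equivalence relation on an object $A$ of a category with finite limits is a jointly monic pair $p_0,p_1\colon R\rightrightarrows A$ that is (i) reflexive: there is $d\colon A\to R$ with $p_0d=p_1d=1_A$; (ii) symmetric: there is $s\colon R\to R$ with $p_0s=p_1$ and $p_1s=p_0$; (iii) transitive: if $\pi_0,\pi_1\colon P\rightrightarrows R$ is the pullback of $p_1$ and $p_0$ (so $p_1\pi_0=p_0\pi_1$), there is $t\colon P\to R$ with $p_0t=p_0\pi_0$ and $p_1t=p_1\pi_1$. It is effective if it has a coequaliser and is the kernel pair of that coequaliser. Theorem. Every internal equivalence relation in $\mathsf{CompOrd}^{\mathrm{op}}$ is effective. Equivalently, let $X$ be a compact ordered space and let $q_0,q_1\colon X\rightrightarrows S$ be an equivalence corelation on $X$, i.e. a jointly epic pair of morphisms of $\mathsf{CompOrd}$ such that there are $d\colon S\to X$ with $dq_0=dq_1=1_X$ and $s\colon S\to S$ with $sq_0=q_1$, $sq_1=q_0$, and such that, whenever $\lambda_0,\lambda_1\colon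 S\rightrightarrows P$ is a pushout of $q_1$ and $q_0$ (so $\lambda_0q_1=\lambda_1q_0$), there is $t\colon S\to P$ with $tq_0=\lambda_0q_0$ and $tq_1=\lambda_1q_1$. Then $q_0,q_1$ have an equaliser $k\colon Y\to X$ in $\mathsf{CompOrd}$, and $q_0,q_1$ is the cokernel pair of $k$, i.e. the pushout of $k$ along itself. -/

import Mathlib

open CategoryTheory CategoryTheory.Limits

universe u

/-- The category of compact ordered spaces: compact topological spaces with a partial order
that is closed in the product space. The Hausdorff property is a consequence. -/
structure CompOrd where
  /-- Bundle a compact ordered space. -/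
  of ::
  /-- The underlying set. -/
  carrier : Type u
  [topology : TopologicalSpace carrier]
  [order : PartialOrder carrier]
  [compact : CompactSpace carrier]
  [orderClosed : OrderClosedTopology carrier]

namespace CompOrd

attribute [instance] topology order compact orderClosed

instance : CoeSort CompOrd.{u} (Type u) := ⟨CompOrd.carrier⟩

/-- Morphisms of compact ordered spaces: continuous order-preserving maps. -/
@[ext]
structure Hom (X Y : CompOrd.{u}) where
  /-- The underlying continuous order-preserving map. -/
  hom' : X →Co Y

instance : Category CompOrd.{u} where
  Hom X Y := Hom X Y
  id X := ⟨ContinuousOrderHom.id X⟩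
  comp f g := ⟨g.hom'.comp f.hom'⟩

instance : ConcreteCategory CompOrd.{u} (fun X Y => X →Co Y) where
  hom := Hom.hom'
  ofHom := Hom.mk

end CompOrd

/-- A pair `q₀, q₁ : X ⟶ S` is an equivalence corelation on `X` if it is jointly epic (that is,
the induced map `X + X ⟶ S` is an epimorphism, so that it presents a quotient object of `X + X`),
reflexive, symmetric and transitive, in the sense dual to that of internal relations. -/
structure IsEquivalenceCorelation {C : Type*} [Category* C] {X S : C} (q₀ q₁ : X ⟶ S) :
    Prop where
  jointly_epi : ∀ ⦃Z : C⦄ (f g : S ⟶ Z), q₀ ≫ f = q₀ ≫ g → q₁ ≫ f = q₁ ≫ g → f = g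
  reflexive : ∃ d : S ⟶ X, q₀ ≫ d = 𝟙 X ∧ q₁ ≫ d = 𝟙 X
  symmetric : ∃ s : S ⟶ S, q₀ ≫ s = q₁ ∧ q₁ ≫ s = q₀
  transitive : ∀ ⦃P : C⦄ (l₀ l₁ : S ⟶ P), IsPushout q₁ q₀ l₀ l₁ →
    ∃ t : S ⟶ P, q₀ ≫ t = q₀ ≫ l₀ ∧ q₁ ≫ t = q₁ ≫ l₁

/-! The common retraction makes `q₀` and `q₁` order embeddings, and joint epicness makes their
images cover `S`. By symmetry, `S` is then determined by the closed relation `r x y := q₀ x ≤ q₁ y`,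
which is contained in the order. Transitivity, tested on an explicit pushout, says that `r` is
interpolative (`exists_interpolant_of_transitive`). By compactness, an interpolative `r` has a
self-related point between any two related points (`exists_self_related_between`), and by symmetry
self-related points lie in the equaliser. So `q₀ x ≤ q₁ y` exactly when `x ≤ z ≤ y` for some `z` in
the equaliser, which is the order of the cokernel pair. -/

theorem IsCompact.exists_minimal_of_isClosed_Iic {α : Type*} [TopologicalSpace α] [Preorder α]
    [ClosedIicTopology α] {K : Set α} (hK : IsCompact K) (hKc : IsClosed K) (hne : K.Nonempty) :
    ∃ m, Minimal (· ∈ K) m := by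
  obtain ⟨x, hx⟩ := hne
  obtain ⟨m, -, hm⟩ := zorn_le_nonempty₀ (α := αᵒᵈ) (OrderDual.ofDual ⁻¹' K)
    (fun c hcK hc y hy => by
    have hne : Nonempty c := ⟨⟨y, hy⟩⟩
    obtain ⟨z, hz⟩ := IsCompact.nonempty_iInter_of_directed_nonempty_isCompact_isClosed
      (fun v : c => K ∩ Set.Iic (OrderDual.ofDual v.1))
      (fun u v => by
        rcases hc.total u.2 v.2 with h | h
        · exact ⟨v, fun z hz => ⟨hz.1, le_trans hz.2 h⟩, subset_rfl⟩
        · exact ⟨u, subset_rfl, fun z hz => ⟨hz.1, le_trans hz.2 h⟩⟩)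
      (fun v => ⟨OrderDual.ofDual v.1, hcK v.2, le_refl _⟩)
      (fun v => hK.inter_right isClosed_Iic)
      (fun v => hKc.inter isClosed_Iic)
    rw [Set.mem_iInter] at hz
    exact ⟨OrderDual.toDual z, (hz ⟨y, hy⟩).1, fun v hv => (hz ⟨v, hv⟩).2⟩) (OrderDual.toDual x) hx
  exact ⟨OrderDual.ofDual m, hm.1, fun y hy hle => hm.2 (y := OrderDual.toDual y) hy hle⟩

/-- A closed interpolative relation on a compact ordered space that is contained in the
order admits, between any two related points, a self-related point. -/
theorem exists_self_related_between {X : Type*} [TopologicalSpace X] [PartialOrder X]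
    [CompactSpace X] [OrderClosedTopology X] {r : X → X → Prop}
    (hclosed : IsClosed {p : X × X | r p.1 p.2}) (hle : ∀ x y, r x y → x ≤ y)
    (hinterp : ∀ x y, r x y → ∃ z, r x z ∧ r z y) {x y : X} (hxy : r x y) :
    ∃ z, x ≤ z ∧ z ≤ y ∧ r z z := by
  have hK : IsClosed {v | r x v ∧ v ≤ y} :=
    (hclosed.preimage (f := fun v => (x, v)) (by fun_prop)).inter isClosed_Iic
  obtain ⟨m, ⟨hxm, hmy⟩, hmin⟩ :=
    hK.isCompact.exists_minimal_of_isClosed_Iic hK ⟨y, hxy, le_rfl⟩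
  -- The interpolant lies below `m` in the same set, so minimality gives `z = m`, and `r z m`
  -- becomes self-relatedness.
  obtain ⟨z, hxz, hzm⟩ := hinterp x m hxm
  have hz := hle z m hzm
  obtain rfl : z = m := le_antisymm hz (hmin ⟨hxz, hz.trans hmy⟩ hz)
  exact ⟨z, hle _ _ hxz, hmy, hzm⟩

namespace CompOrd

/-! ### Quotients of compact spaces by closed preorders -/

section Quotient

variable {Z : Type*} {r : Z → Z → Prop}

/-- The equivalence relation associated with a preorder relation. -/
def preorderSetoid (hrefl : ∀ a, r a a) (htrans : ∀ a b c, r a b → r b c → r a c) : Setoid Z where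
  r a b := r a b ∧ r b a
  iseqv := ⟨fun a => ⟨hrefl a, hrefl a⟩, fun h => ⟨h.2, h.1⟩,
    fun h h' => ⟨htrans _ _ _ h.1 h'.1, htrans _ _ _ h'.2 h.2⟩⟩

variable (hrefl : ∀ a, r a a) (htrans : ∀ a b c, r a b → r b c → r a c)

/-- The partial order on the quotient by the equivalence relation associated with a preorder
relation. -/
abbrev quotientPartialOrder : PartialOrder (Quotient (preorderSetoid hrefl htrans)) where
  le := Quotient.lift₂ r fun _ _ _ _ h h' => propext
    ⟨fun k => htrans _ _ _ h.2 (htrans _ _ _ k h'.1),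
      fun k => htrans _ _ _ h.1 (htrans _ _ _ k h'.2)⟩
  le_refl := by rintro ⟨a⟩; exact hrefl a
  le_trans := by rintro ⟨a⟩ ⟨b⟩ ⟨c⟩; exact htrans a b c
  le_antisymm := by rintro ⟨a⟩ ⟨b⟩ h h'; exact Quotient.sound ⟨h, h'⟩

variable [TopologicalSpace Z] [CompactSpace Z]

/-- The saturation of a closed set is the projection of a closed set along a compact factor.
Properness, unlike closedness, passes to products, so the quotient order is closed as the image of
`r`. -/
theorem isProperMap_mk_preorderSetoid (hclosed : IsClosed {p : Z × Z | r p.1 p.2}) :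
    IsProperMap (Quotient.mk (preorderSetoid hrefl htrans)) := by
  have hsymm : IsClosed {p : Z × Z | r p.1 p.2 ∧ r p.2 p.1} :=
    hclosed.inter (hclosed.preimage continuous_swap)
  rw [isProperMap_iff_isClosedMap_and_compact_fibers]
  refine ⟨continuous_quotient_mk', fun C hC => ?_, ?_⟩
  · rw [← isQuotientMap_quotient_mk'.isClosed_preimage]
    convert isClosedMap_snd_of_compactSpace _ (hsymm.inter (hC.preimage continuous_fst)) using 1
    ext b
    constructor
    · rintro ⟨a, ha, hab⟩
      exact ⟨(a, b), ⟨Quotient.exact hab, ha⟩, rfl⟩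
    · rintro ⟨⟨a, b⟩, ⟨hab, ha⟩, rfl⟩
      exact ⟨a, ha, Quotient.sound hab⟩
  · rintro ⟨b⟩
    apply IsClosed.isCompact
    convert hsymm.preimage (f := fun a => (a, b)) (by fun_prop) using 1
    ext a
    exact Quotient.eq

/-- The quotient of a compact space by a closed preorder relation. -/
def ofClosedPreorder (hclosed : IsClosed {p : Z × Z | r p.1 p.2}) : CompOrd :=
  letI := quotientPartialOrder hrefl htrans
  haveI : OrderClosedTopology (Quotient (preorderSetoid hrefl htrans)) := ⟨by
    have hp := isProperMap_mk_preorderSetoid hrefl htrans hclosed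
    convert (hp.prodMap hp).isClosedMap _ hclosed using 1
    ext ⟨a, b⟩
    constructor
    · induction a using Quotient.inductionOn
      induction b using Quotient.inductionOn
      exact fun h => ⟨(_, _), h, rfl⟩
    · rintro ⟨⟨a, b⟩, h, heq⟩
      cases heq
      exact h⟩
  .of (Quotient (preorderSetoid hrefl htrans))

end Quotient

/-! ### Pushouts of order embeddings -/

section Amalgam

variable {X A B : CompOrd.{u}} (f : X ⟶ A) (g : X ⟶ B)

theorem hom_monotone {X Y : CompOrd.{u}} (f : X ⟶ Y) : Monotone f :=
  (ConcreteCategory.hom f).monotone'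

theorem hom_continuous {X Y : CompOrd.{u}} (f : X ⟶ Y) : Continuous f :=
  (ConcreteCategory.hom f).continuous_toFun

/-- The preorder on the disjoint union of `A` and `B` whose quotient is the pushout of `f` and `g`,
if these are order embeddings. -/
def amalgamRel : A ⊕ B → A ⊕ B → Prop
  | .inl a, .inl a' => a ≤ a'
  | .inr b, .inr b' => b ≤ b'
  | .inl a, .inr b => ∃ x, a ≤ f x ∧ g x ≤ b
  | .inr b, .inl a => ∃ x, b ≤ g x ∧ f x ≤ a

theorem amalgamRel_refl (a : A ⊕ B) : amalgamRel f g a a := by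
  cases a <;> exact le_rfl

variable {f g} in
-- A path that crosses to the other summand and back meets `g x ≤ g y` or `f x ≤ f y` there; the
-- embedding hypothesis carries this back to `X`.
theorem amalgamRel_trans (hf : ∀ x y, f x ≤ f y → x ≤ y) (hg : ∀ x y, g x ≤ g y → x ≤ y)
    (a b c : A ⊕ B) (hab : amalgamRel f g a b) (hbc : amalgamRel f g b c) :
    amalgamRel f g a c := by
  rcases a with a | a <;> rcases b with b | b <;> rcases c with c | c
  · exact le_trans (α := A) hab hbc
  · obtain ⟨x, h, h'⟩ := hbc
    exact ⟨x, le_trans hab h, h'⟩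
  · obtain ⟨x, h, h'⟩ := hab
    obtain ⟨y, k, k'⟩ := hbc
    exact h.trans ((hom_monotone f (hg x y (h'.trans k))).trans k')
  · obtain ⟨x, h, h'⟩ := hab
    exact ⟨x, h, h'.trans hbc⟩
  · obtain ⟨x, h, h'⟩ := hab
    exact ⟨x, h, h'.trans hbc⟩
  · obtain ⟨x, h, h'⟩ := hab
    obtain ⟨y, k, k'⟩ := hbc
    exact h.trans ((hom_monotone g (hf x y (h'.trans k))).trans k')
  · obtain ⟨x, h, h'⟩ := hbc
    exact ⟨x, le_trans hab h, h'⟩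
  · exact le_trans (α := B) hab hbc

theorem isClosed_exists_between :
    IsClosed {p : A × B | ∃ x, p.1 ≤ f x ∧ g x ≤ p.2} := by
  have hf := hom_continuous f
  have hg := hom_continuous g
  have h : IsClosed {p : X × (A × B) | p.2.1 ≤ f p.1 ∧ g p.1 ≤ p.2.2} :=
    (isClosed_le (by fun_prop) (by fun_prop)).inter (isClosed_le (by fun_prop) (by fun_prop))
  convert isClosedMap_snd_of_compactSpace _ h using 1
  ext p
  simp

theorem isClosed_amalgamRel :
    IsClosed {p : (A ⊕ B) × (A ⊕ B) | amalgamRel f g p.1 p.2} := by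
  have key : ∀ U : Set ((A ⊕ B) × (A ⊕ B)),
      IsClosed (Prod.map Sum.inl Sum.inl ⁻¹' U) → IsClosed (Prod.map Sum.inl Sum.inr ⁻¹' U) →
      IsClosed (Prod.map Sum.inr Sum.inl ⁻¹' U) → IsClosed (Prod.map Sum.inr Sum.inr ⁻¹' U) →
      IsClosed U := by
    intro U h₁ h₂ h₃ h₄
    have hl := Topology.IsClosedEmbedding.inl (X := A) (Y := B)
    have hr := Topology.IsClosedEmbedding.inr (X := A) (Y := B)
    convert (((hl.prodMap hl).isClosedMap _ h₁).union ((hl.prodMap hr).isClosedMap _ h₂)).union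
      (((hr.prodMap hl).isClosedMap _ h₃).union ((hr.prodMap hr).isClosedMap _ h₄)) using 1
    ext ⟨a | a, b | b⟩ <;> simp
  apply key
  · exact isClosed_le (α := A) continuous_fst continuous_snd
  · exact isClosed_exists_between f g
  · exact isClosed_exists_between g f
  · exact isClosed_le (α := B) continuous_fst continuous_snd

variable {f g} (hf : ∀ x y, f x ≤ f y → x ≤ y) (hg : ∀ x y, g x ≤ g y → x ≤ y)

/-- The pushout of two order embeddings of compact ordered spaces. -/
def amalgam : CompOrd.{u} :=
  ofClosedPreorder (amalgamRel_refl f g) (amalgamRel_trans hf hg) (isClosed_amalgamRel f g)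

/-- The left inclusion into the pushout of two order embeddings. -/
def amalgamInl : A ⟶ amalgam hf hg :=
  ConcreteCategory.ofHom (C := CompOrd)
    { toFun := fun a => Quotient.mk _ (.inl a)
      monotone' := fun _ _ h => h
      continuous_toFun := continuous_quotient_mk'.comp continuous_inl }

/-- The right inclusion into the pushout of two order embeddings. -/
def amalgamInr : B ⟶ amalgam hf hg :=
  ConcreteCategory.ofHom (C := CompOrd)
    { toFun := fun b => Quotient.mk _ (.inr b)
      monotone' := fun _ _ h => h
      continuous_toFun := continuous_quotient_mk'.comp continuous_inr }

theorem amalgamInl_le_amalgamInr {a : A} {b : B} :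
    amalgamInl hf hg a ≤ amalgamInr hf hg b ↔ ∃ x, a ≤ f x ∧ g x ≤ b := Iff.rfl

theorem amalgam_condition : f ≫ amalgamInl hf hg = g ≫ amalgamInr hf hg := by
  ext x
  exact Quotient.sound ⟨⟨x, le_rfl, le_rfl⟩, ⟨x, le_rfl, le_rfl⟩⟩

theorem amalgamRel_elim_le {T : CompOrd.{u}} {h : A ⟶ T} {k : B ⟶ T} (w : f ≫ h = g ≫ k)
    (a b : A ⊕ B) (hab : amalgamRel f g a b) :
    Sum.elim h k a ≤ Sum.elim h k b := by
  have w' (x : X) : h (f x) = k (g x) := ConcreteCategory.congr_hom w x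
  rcases a with a | a <;> rcases b with b | b
  · exact hom_monotone h hab
  · obtain ⟨x, h₁, h₂⟩ := hab
    exact (hom_monotone h h₁).trans ((w' x).le.trans (hom_monotone k h₂))
  · obtain ⟨x, h₁, h₂⟩ := hab
    exact (hom_monotone k h₁).trans ((w' x).ge.trans (hom_monotone h h₂))
  · exact hom_monotone k hab

/-- The universal property of the pushout of two order embeddings. -/
def amalgamDesc {T : CompOrd.{u}} (h : A ⟶ T) (k : B ⟶ T) (w : f ≫ h = g ≫ k) :
    amalgam hf hg ⟶ T :=
  ConcreteCategory.ofHom (C := CompOrd)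
    { toFun := Quotient.lift (Sum.elim h k) fun a b hab =>
        le_antisymm (amalgamRel_elim_le w a b hab.1) (amalgamRel_elim_le w b a hab.2)
      monotone' := by
        rintro ⟨a⟩ ⟨b⟩ hab
        exact amalgamRel_elim_le w a b hab
      continuous_toFun :=
        ((hom_continuous h).sumElim (hom_continuous k)).quotient_lift _ }

theorem isPushout_amalgam : IsPushout f g (amalgamInl hf hg) (amalgamInr hf hg) :=
  ⟨⟨amalgam_condition hf hg⟩, ⟨PushoutCocone.IsColimit.mk _
    (fun s => amalgamDesc hf hg s.inl s.inr s.condition)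
    (fun s => rfl) (fun s => rfl) (fun s m hl hr => by
      ext ⟨a | b⟩
      · exact ConcreteCategory.congr_hom hl a
      · exact ConcreteCategory.congr_hom hr b)⟩⟩

end Amalgam

/-! ### Closed subspaces, equalisers and corelations -/

/-- A closed subset of a compact ordered space. -/
def ofIsClosed {X : CompOrd.{u}} {K : Set X} (hK : IsClosed K) : CompOrd.{u} :=
  haveI : CompactSpace K := isCompact_iff_compactSpace.mp hK.isCompact
  .of K

/-- The inclusion of a closed subset of a compact ordered space. -/
def inclusion {X : CompOrd.{u}} {K : Set X} (hK : IsClosed K) : ofIsClosed hK ⟶ X :=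
  ConcreteCategory.ofHom (C := CompOrd)
    { toFun := Subtype.val
      monotone' := fun _ _ h => h
      continuous_toFun := continuous_subtype_val }

variable {X S : CompOrd.{u}} {q₀ q₁ : X ⟶ S}

/-- Glue two copies of `S` along the union `K` of the images. The two inclusions agree on `K`, hence
everywhere, and comparing the two copies of `s` yields a point of `K` both above and below `s`. -/
theorem exists_eq_or_eq_of_jointly_epi
    (hepi : ∀ ⦃Z : CompOrd.{u}⦄ (f g : S ⟶ Z), q₀ ≫ f = q₀ ≫ g → q₁ ≫ f = q₁ ≫ g → f = g)
    (s : S) : (∃ x, q₀ x = s) ∨ ∃ x, q₁ x = s := by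
  have hK : IsClosed (Set.range q₀ ∪ Set.range q₁) :=
    (isCompact_range (hom_continuous q₀)).isClosed.union
      (isCompact_range (hom_continuous q₁)).isClosed
  have hi : ∀ x y, inclusion hK x ≤ inclusion hK y → x ≤ y := fun _ _ h => h
  have heq := hepi (amalgamInl hi hi) (amalgamInr hi hi)
    (by ext x; exact ConcreteCategory.congr_hom (amalgam_condition hi hi) ⟨q₀ x, .inl ⟨x, rfl⟩⟩)
    (by ext x; exact ConcreteCategory.congr_hom (amalgam_condition hi hi) ⟨q₁ x, .inr ⟨x, rfl⟩⟩)
  obtain ⟨x, h, h'⟩ := (amalgamInl_le_amalgamInr hi hi).1 (ConcreteCategory.congr_hom heq s).le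
  obtain rfl : s = x.1 := le_antisymm h h'
  exact x.2

theorem le_of_retraction {q : X ⟶ S} {d : S ⟶ X} (hd : q ≫ d = 𝟙 X) (x y : X)
    (h : q x ≤ q y) : x ≤ y := by
  have h' := hom_monotone d h
  rwa [← ConcreteCategory.comp_apply, ← ConcreteCategory.comp_apply, hd] at h'

theorem isClosed_equalizer (q₀ q₁ : X ⟶ S) : IsClosed {x | q₀ x = q₁ x} :=
  isClosed_eq (hom_continuous q₀) (hom_continuous q₁)

theorem equalizer_condition (q₀ q₁ : X ⟶ S) :
    inclusion (isClosed_equalizer q₀ q₁) ≫ q₀ = inclusion (isClosed_equalizer q₀ q₁) ≫ q₁ := by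
  ext x
  exact x.2

/-- The inclusion of the subspace where two morphisms agree is their equaliser. -/
def isLimitEqualizer (q₀ q₁ : X ⟶ S) :
    IsLimit (Fork.ofι (inclusion (isClosed_equalizer q₀ q₁)) (equalizer_condition q₀ q₁)) :=
  Fork.IsLimit.mk _
    (fun s => ConcreteCategory.ofHom (C := CompOrd)
      { toFun := fun x => ⟨s.ι x, ConcreteCategory.congr_hom s.condition x⟩
        monotone' := fun _ _ h => hom_monotone s.ι h
        continuous_toFun := (hom_continuous s.ι).subtype_mk _ })
    (fun s => rfl)
    (fun s m hm => by
      ext x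
      exact Subtype.ext (ConcreteCategory.congr_hom hm x))

/-- Following `t` by the comparison map to the amalgam sends `q₀ x ≤ q₁ y` to an inequality from the
left copy of `S` to the right one, which must factor through the glued `X`. -/
theorem exists_interpolant_of_transitive {d : S ⟶ X} (hd₀ : q₀ ≫ d = 𝟙 X) (hd₁ : q₁ ≫ d = 𝟙 X)
    {P : CompOrd.{u}} {l₀ l₁ : S ⟶ P} (hP : IsPushout q₁ q₀ l₀ l₁) {t : S ⟶ P}
    (ht₀ : q₀ ≫ t = q₀ ≫ l₀) (ht₁ : q₁ ≫ t = q₁ ≫ l₁) (x y : X) (hxy : q₀ x ≤ q₁ y) :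
    ∃ z, q₀ x ≤ q₁ z ∧ q₀ z ≤ q₁ y := by
  have h₀ := le_of_retraction hd₀
  have h₁ := le_of_retraction hd₁
  have hw := amalgam_condition h₁ h₀
  have e₀ : q₀ ≫ t ≫ hP.desc _ _ hw = q₀ ≫ amalgamInl h₁ h₀ := by
    rw [reassoc_of% ht₀, hP.inl_desc]
  have e₁ : q₁ ≫ t ≫ hP.desc _ _ hw = q₁ ≫ amalgamInr h₁ h₀ := by
    rw [reassoc_of% ht₁, hP.inr_desc]
  have h := hom_monotone (t ≫ hP.desc _ _ hw) hxy
  rw [← ConcreteCategory.comp_apply, ← ConcreteCategory.comp_apply, e₀, e₁] at h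
  exact (amalgamInl_le_amalgamInr h₁ h₀).1 h

theorem exists_mem_equalizer_between {d : S ⟶ X} (hd₀ : q₀ ≫ d = 𝟙 X) (hd₁ : q₁ ≫ d = 𝟙 X)
    {s : S ⟶ S} (hs₀ : q₀ ≫ s = q₁) (hs₁ : q₁ ≫ s = q₀)
    (hinterp : ∀ x y, q₀ x ≤ q₁ y → ∃ z, q₀ x ≤ q₁ z ∧ q₀ z ≤ q₁ y)
    {x y : X} (hxy : q₀ x ≤ q₁ y) : ∃ z, x ≤ z ∧ z ≤ y ∧ q₀ z = q₁ z := by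
  have c₀ := hom_continuous q₀
  have c₁ := hom_continuous q₁
  obtain ⟨z, h, h', hz⟩ := exists_self_related_between (r := fun x y => q₀ x ≤ q₁ y)
    (isClosed_le (by fun_prop) (by fun_prop))
    (fun x y h => by
      have h' := hom_monotone d h
      rwa [← ConcreteCategory.comp_apply, ← ConcreteCategory.comp_apply, hd₀, hd₁] at h')
    hinterp hxy
  refine ⟨z, h, h', le_antisymm hz ?_⟩
  have h' := hom_monotone s hz
  rwa [← ConcreteCategory.comp_apply, ← ConcreteCategory.comp_apply, hs₀, hs₁] at h'

theorem isPushout_equalizer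
    (hepi : ∀ ⦃Z : CompOrd.{u}⦄ (f g : S ⟶ Z), q₀ ≫ f = q₀ ≫ g → q₁ ≫ f = q₁ ≫ g → f = g)
    {d : S ⟶ X} (hd₀ : q₀ ≫ d = 𝟙 X) (hd₁ : q₁ ≫ d = 𝟙 X)
    {s : S ⟶ S} (hs₀ : q₀ ≫ s = q₁) (hs₁ : q₁ ≫ s = q₀)
    (hinterp : ∀ x y, q₀ x ≤ q₁ y → ∃ z, q₀ x ≤ q₁ z ∧ q₀ z ≤ q₁ y) :
    IsPushout (inclusion (isClosed_equalizer q₀ q₁)) (inclusion (isClosed_equalizer q₀ q₁))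
      q₀ q₁ := by
  have hclosed : IsClosedMap (Sum.elim q₀ q₁) :=
    ((hom_continuous q₀).sumElim (hom_continuous q₁)).isClosedMap
  have hquot : Topology.IsQuotientMap (Sum.elim q₀ q₁) :=
    hclosed.isQuotientMap ((hom_continuous q₀).sumElim (hom_continuous q₁)) fun s => by
      rcases exists_eq_or_eq_of_jointly_epi hepi s with ⟨x, hx⟩ | ⟨x, hx⟩
      · exact ⟨.inl x, hx⟩
      · exact ⟨.inr x, hx⟩
  have hswap (x : X) : s (q₀ x) = q₁ x ∧ s (q₁ x) = q₀ x :=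
    ⟨ConcreteCategory.congr_hom hs₀ x, ConcreteCategory.congr_hom hs₁ x⟩
  have hrel (a b : X ⊕ X) (hab : Sum.elim q₀ q₁ a ≤ Sum.elim q₀ q₁ b) :
      amalgamRel (inclusion (isClosed_equalizer q₀ q₁))
        (inclusion (isClosed_equalizer q₀ q₁)) a b := by
    rcases a with a | a <;> rcases b with b | b
    · exact le_of_retraction hd₀ a b hab
    · obtain ⟨z, h, h', hz⟩ := exists_mem_equalizer_between hd₀ hd₁ hs₀ hs₁ hinterp hab
      exact ⟨⟨z, hz⟩, h, h'⟩
    -- The swap `s` reduces `q₁ a ≤ q₀ b` to the previous mixed case.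
    · have hab' := hom_monotone s hab
      simp only [Sum.elim_inl, Sum.elim_inr, hswap] at hab'
      obtain ⟨z, h, h', hz⟩ := exists_mem_equalizer_between hd₀ hd₁ hs₀ hs₁ hinterp hab'
      exact ⟨⟨z, hz⟩, h, h'⟩
    · exact le_of_retraction hd₁ a b hab
  have hdesc ⦃T : CompOrd.{u}⦄ (f g : X ⟶ T)
      (w : inclusion (isClosed_equalizer q₀ q₁) ≫ f = inclusion (isClosed_equalizer q₀ q₁) ≫ g) :
      ∃ m : S ⟶ T, q₀ ≫ m = f ∧ q₁ ≫ m = g := by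
    -- The choice of preimage is immaterial: by `hrel`, preimages of one point are related both
    -- ways, so their values in `T` agree by antisymmetry.
    let φ (p : S) : T := Sum.elim f g (hquot.surjective p).choose
    have hφ (a : X ⊕ X) : φ (Sum.elim q₀ q₁ a) = Sum.elim f g a := by
      have ha := (hquot.surjective (Sum.elim q₀ q₁ a)).choose_spec
      exact le_antisymm (amalgamRel_elim_le w _ _ (hrel _ _ ha.le))
        (amalgamRel_elim_le w _ _ (hrel _ _ ha.ge))
    refine ⟨ConcreteCategory.ofHom (C := CompOrd)
      { toFun := φ
        monotone' := fun p p' hp => amalgamRel_elim_le w _ _ (hrel _ _ (by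
          rwa [(hquot.surjective p).choose_spec, (hquot.surjective p').choose_spec]))
        continuous_toFun := by
          rw [hquot.continuous_iff, funext hφ (f := φ ∘ Sum.elim q₀ q₁)]
          exact (hom_continuous f).sumElim (hom_continuous g) }, ?_, ?_⟩
    · ext a
      exact hφ (.inl a)
    · ext a
      exact hφ (.inr a)
  choose m hm₀ hm₁ using hdesc
  exact ⟨⟨equalizer_condition q₀ q₁⟩, ⟨PushoutCocone.IsColimit.mk _
    (fun c => m c.inl c.inr c.condition) (fun c => hm₀ _ _ _) (fun c => hm₁ _ _ _)
    (fun c n h₀ h₁ => hepi _ _ (h₀.trans (hm₀ _ _ _).symm) (h₁.trans (hm₁ _ _ _).symm))⟩⟩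

end CompOrd

/-- A fork of a pair with a common retraction that is an equaliser is a pullback square. -/
theorem isPullback_of_isLimit_fork {C : Type*} [Category* C] {Y X S : C} {k : Y ⟶ X}
    {q₀ q₁ : X ⟶ S} {w : k ≫ q₀ = k ≫ q₁} (hk : IsLimit (Fork.ofι k w)) {d : S ⟶ X}
    (hd₀ : q₀ ≫ d = 𝟙 X) (hd₁ : q₁ ≫ d = 𝟙 X) : IsPullback k k q₀ q₁ := by
  -- Composing with the common retraction identifies the two legs, so cones over the cospan are
  -- forks.
  have heq (c : PullbackCone q₀ q₁) : c.fst = c.snd := by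
    simpa [hd₀, hd₁] using congr($(c.condition) ≫ d)
  have hc (c : PullbackCone q₀ q₁) : c.fst ≫ q₀ = c.fst ≫ q₁ := by
    rw [c.condition, heq c]
  refine ⟨⟨w⟩, ⟨PullbackCone.IsLimit.mk _ (fun c => Fork.IsLimit.lift hk c.fst (hc c)) ?_ ?_ ?_⟩⟩
  · exact fun c => Fork.IsLimit.lift_ι' hk _ _
  · exact fun c => (Fork.IsLimit.lift_ι' hk _ _).trans (heq c)
  · exact fun c m hm _ => Fork.IsLimit.hom_ext hk (hm.trans (Fork.IsLimit.lift_ι' hk _ _).symm)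

/-- Every internal equivalence relation in the opposite of the category of compact ordered spaces
is effective; that is, every equivalence corelation on a compact ordered space is the cokernel
pair of its equaliser. -/
theorem mainTheorem2 :
    (∀ {R A : CompOrd.{u}ᵒᵖ} (p₀ p₁ : R ⟶ A),
      IsEquivalenceRelation p₀ p₁ → IsEffectiveEquivalenceRelation p₀ p₁) ∧
    (∀ {X S : CompOrd.{u}} (q₀ q₁ : X ⟶ S), IsEquivalenceCorelation q₀ q₁ →
      ∃ (Y : CompOrd.{u}) (k : Y ⟶ X) (w : k ≫ q₀ = k ≫ q₁),
        Nonempty (IsLimit (Fork.ofι k w)) ∧ IsPushout k k q₀ q₁) := by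
  refine ⟨fun {R A} p₀ p₁ ⟨⟨e⟩⟩ => ?_, fun {X S} q₀ q₁ h => ?_⟩
  · have hd₀ : p₀.unop ≫ e.r.unop = 𝟙 _ := congr(Quiver.Hom.unop $(e.reflexivity₁))
    have hd₁ : p₁.unop ≫ e.r.unop = 𝟙 _ := congr(Quiver.Hom.unop $(e.reflexivity₂))
    have hs₀ : p₀.unop ≫ e.s.unop = p₁.unop := congr(Quiver.Hom.unop $(e.symmetry₁))
    have hs₁ : p₁.unop ≫ e.s.unop = p₀.unop := congr(Quiver.Hom.unop $(e.symmetry₂))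
    have ht₀ : p₀.unop ≫ e.t.unop = p₀.unop ≫ e.c.fst.unop :=
      congr(Quiver.Hom.unop $(e.transitivity₁))
    have ht₁ : p₁.unop ≫ e.t.unop = p₁.unop ≫ e.c.snd.unop :=
      congr(Quiver.Hom.unop $(e.transitivity₂))
    have hepi ⦃Z : CompOrd.{u}⦄ (f g : R.unop ⟶ Z) (h₀ : p₀.unop ≫ f = p₀.unop ≫ g)
        (h₁ : p₁.unop ≫ f = p₁.unop ≫ g) : f = g :=
      Quiver.Hom.op_inj (e.right_cancellation f.op g.op congr(Quiver.Hom.op $h₀)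
        congr(Quiver.Hom.op $h₁))
    have hP : IsPushout p₁.unop p₀.unop e.c.fst.unop e.c.snd.unop :=
      (IsPullback.of_isLimit e.isLimit).unop.flip
    have hpush := CompOrd.isPushout_equalizer hepi hd₀ hd₁ hs₀ hs₁
      (CompOrd.exists_interpolant_of_transitive hd₀ hd₁ hP ht₀ ht₁)
    have hpull := isPullback_of_isLimit_fork
      (CompOrd.isLimitEqualizer p₀.unop p₁.unop) hd₀ hd₁
    exact ⟨⟨{ e with
      B := _
      π := (CompOrd.inclusion (CompOrd.isClosed_equalizer p₀.unop p₁.unop)).op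
      isKernelPair := hpush.op.flip
      isPushout := hpull.op.flip }⟩⟩
  · obtain ⟨d, hd₀, hd₁⟩ := h.reflexive
    obtain ⟨s, hs₀, hs₁⟩ := h.symmetric
    have hP := CompOrd.isPushout_amalgam (CompOrd.le_of_retraction hd₁)
      (CompOrd.le_of_retraction hd₀)
    obtain ⟨t, ht₀, ht₁⟩ := h.transitive _ _ hP
    exact ⟨_, _, CompOrd.equalizer_condition q₀ q₁, ⟨CompOrd.isLimitEqualizer q₀ q₁⟩,
      CompOrd.isPushout_equalizer h.jointly_epi hd₀ hd₁ hs₀ hs₁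
        (CompOrd.exists_interpolant_of_transitive hd₀ hd₁ hP ht₀ ht₁)⟩
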